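/- \textbf{Setting.} Let $n,m\ge 0$ be integers, $a,b\in\mathbb{R}$, and let $Z\subseteq\mathbb{R}^n\times\mathbb{R}^m$ be permutation-invariant in $x$: $(x,z)\in Z$ implies $(Px,z)\in Z$ for all $n\times n$ permutation matrices $P$. Put $S(Z,a,b)=\{(x,z)\in Z\mid x\in[a,b]^n\}$ and, for a collection $\mathcal{F}$ of faces of $[a,b]^n$, put $X(Z,a,b,\mathcal{F})=\{(x,z)\in S(Z,a,b)\mid x\in\bigcup_{F\in\mathcal{F}}F\}$. Call $\mathcal{F}$ permutation-invariant if it contains all faces obtained from its members by permuting coordinates. For a face $F$ let $u(F)$ and $l(F)$ be the sets of coordinates that equal $b$, respectively $a$, at all points of $F$; $F$ is \emph{hole-free} if $u(F)=\{1,\dots,p\}$ and $l(F)=\{q,\dots,n\}$ for some $p<q$. Write $u\ge_m x$ if $\sum_{i=1}^{j}u_{[i]}\ge\sum_{i=1}^{j}x_{[i]}$ for $1\le j\le n-1$, with equality of the sums for $j=n$, where $x_{[i]}$ denotes the $i$-th largest component of $x$. Fix any class $\mathcal{K}$ of convex cones containing the origin in finite-dimensional real spaces (the empty class gives linear formulations).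 An \emph{extended formulation} of $Y\subseteq\mathbb{R}^n\times\mathbb{R}^m$ is a finite system of affine inequalities and of constraints ``an affine image of the variables lies in a cone of $\mathcal{K}$'', in the variables $(x,z)$ and finitely many additional variables, whose solution set projects onto $Y$. Its size is the number of variables plus the number of constraints plus the total dimension of the cones used. For a family of sets indexed by instances $i$, each with a size parameter $s_i\ge n_i+m_i$, the formulations are of \emph{polynomial size} if one polynomial in $s_i$ bounds the sizes for all members of the family. \textbf{Theorem.} \begin{enumerate} \item Consider a family of instances $(n,m,a,b,Z,\mathcal{F})$ such that in each of them $Z$ is compact and permutation-invariant in $x$ and $\mathrm{conv}(S(Z,a,b))=\mathrm{conv}(X(Z,a,b,\mathcal{F}))$. If the sets $\mathrm{conv}(X(Z,a,b,\{F\}))$, $F\in\mathcal{F}$, have polynomial-size extended formulations, then the sets $\mathrm{conv}(S(Z,a,b))$ have polynomial-size extended formulations, irrespective of the number of faces in $\mathcal{F}$. More precisely, there is a polynomial $q$, independent of $\mathcal{K}$ and of the instance, such that if each $\mathrm{conv}(X(Z,a,b,\{F\}))$, $F\in\mathcal{F}$, has an extended formulation of size at most $N$, then $\mathrm{conv}(S(Z,a,b))$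 has one of size at most $q(n+m+N)$. \item Let $a\ne b$, let $Z$ be permutation-invariant in $x$ (not necessarily compact), and let $\mathcal{F}$ be a permutation-invariant collection of faces of $[a,b]^n$. Let $I$ be the set of hole-free members of $\mathcal{F}$. Then \[\mathrm{conv}(X(Z,a,b,\mathcal{F}))=\Bigl\{(x,z)\Bigm| \exists u:\ (u,z)\in\mathrm{conv}\Bigl(\bigcup_{F\in I}X(Z,a,b,\{F\})\Bigr),\ u_1\ge\dots\ge u_n,\ u\ge_m x\Bigr\}.\] \item Let $a\ne b$, let $Z$ be permutation-invariant in $x$, and let $\mathcal{F}$ be any collection of faces of $[a,b]^n$ with $\mathrm{conv}(S(Z,a,b))=\mathrm{conv}(X(Z,a,b,\mathcal{F}))$. Then $\mathrm{conv}(S(Z,a,b))$ equals the right-hand side in 2 with $I$ the set of hole-free faces among all permutations of members of $\mathcal{F}$. \item For $n\ge1$, $[a,b]^n$ has at most $\binom{n+2}{2}$ hole-free faces. \end{enumerate} -/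

import Mathlib

universe u v

namespace PermHull

/-! ### Points, permutations, and the sets being convexified -/

/-- The ambient space of points `(x, z)` with `x ∈ ℝⁿ` and `z ∈ ℝᵐ`. -/
abbrev Pt (n m : ℕ) : Type := (Fin n → ℝ) × (Fin m → ℝ)

/-- The hypercube `[a,b]ⁿ`. -/
def cube (n : ℕ) (a b : ℝ) : Set (Fin n → ℝ) := {x | ∀ i, a ≤ x i ∧ x i ≤ b}

/-- `Z` is permutation-invariant with respect to `x`. -/
def PermInvariant {n m : ℕ} (Z : Set (Pt n m)) : Prop :=
  ∀ x z, (x, z) ∈ Z → ∀ σ : Equiv.Perm (Fin n), (x ∘ σ, z) ∈ Z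

/-- `S(Z,a,b)`: the points of `Z` whose `x` part lies in `[a,b]ⁿ`. -/
def setS {n m : ℕ} (Z : Set (Pt n m)) (a b : ℝ) : Set (Pt n m) :=
  {p | p.1 ∈ cube n a b ∧ p ∈ Z}

/-- `X(Z,a,b,𝓕)`: the points of `S(Z,a,b)` whose `x` part lies in some member of `𝓕`. -/
def setX {n m : ℕ} (Z : Set (Pt n m)) (a b : ℝ) (𝓕 : Set (Set (Fin n → ℝ))) : Set (Pt n m) :=
  {p | p.1 ∈ cube n a b ∧ p ∈ Z ∧ ∃ F ∈ 𝓕, p.1 ∈ F}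

/-! ### Faces of the hypercube -/

/-- Faces of `[a,b]ⁿ`: the sets of maximizers over `[a,b]ⁿ` of a linear functional (the zero
functional gives the hypercube itself), and the empty set. -/
def IsCubeFace {n : ℕ} (a b : ℝ) (F : Set (Fin n → ℝ)) : Prop :=
  IsExposed ℝ (cube n a b) F

/-- The face obtained from `F` by permuting the coordinates. -/
def permFace {n : ℕ} (σ : Equiv.Perm (Fin n)) (F : Set (Fin n → ℝ)) : Set (Fin n → ℝ) :=
  {x | x ∘ σ ∈ F}

/-- A collection of faces that contains all permutations of its members. -/
def FacesPermInvariant {n : ℕ} (𝓕 : Set (Set (Fin n → ℝ))) : Prop :=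
  ∀ F ∈ 𝓕, ∀ σ : Equiv.Perm (Fin n), permFace σ F ∈ 𝓕

/-- The collection of all permutations of the members of `𝓕`. -/
def permClosure {n : ℕ} (𝓕 : Set (Set (Fin n → ℝ))) : Set (Set (Fin n → ℝ)) :=
  {G | ∃ F ∈ 𝓕, ∃ σ : Equiv.Perm (Fin n), G = permFace σ F}

/-- `fixedAt c F`: the coordinates that equal `c` at all points of `F`.
Thus `l(F) = fixedAt a F` and `u(F) = fixedAt b F`. -/
def fixedAt {n : ℕ} (c : ℝ) (F : Set (Fin n → ℝ)) : Set (Fin n) :=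
  {j | ∀ x ∈ F, x j = c}

/-- `F` is hole-free: for some `p < q`, the coordinates fixed at `b` are the first `p` ones
and the coordinates fixed at `a` are those from the `q`-th on (coordinates counted from 1,
so the element `j : Fin n` is coordinate number `j + 1`). -/
def HoleFree {n : ℕ} (a b : ℝ) (F : Set (Fin n → ℝ)) : Prop :=
  ∃ p q : ℕ, p < q ∧
    fixedAt b F = {j : Fin n | (j : ℕ) + 1 ≤ p} ∧
    fixedAt a F = {j : Fin n | q ≤ (j : ℕ) + 1}

/-! ### Majorization -/

/-- The components of `x` in nonincreasing order: `sortedDesc x i` is the component `x_{[i+1]}`. -/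
noncomputable def sortedDesc {n : ℕ} (x : Fin n → ℝ) : Fin n → ℝ := fun i => x (Tuple.sort x i.rev)

/-- The sum of the first `j` components of a vector. -/
noncomputable def partialSum {n : ℕ} (y : Fin n → ℝ) (j : ℕ) : ℝ :=
  ∑ i ∈ Finset.univ.filter (fun i : Fin n => (i : ℕ) < j), y i

/-- `x` majorizes `y`. -/
def Majorizes {n : ℕ} (x y : Fin n → ℝ) : Prop :=
  (∀ j : ℕ, 1 ≤ j → j < n →
    partialSum (sortedDesc y) j ≤ partialSum (sortedDesc x) j) ∧
  partialSum (sortedDesc x) n = partialSum (sortedDesc y) n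

/-- The set of all `(x, z)` for which there is a nonincreasing `u` that majorizes `x` and
satisfies `(u, z) ∈ C`. -/
def majorized {n m : ℕ} (C : Set (Pt n m)) : Set (Pt n m) :=
  {p | ∃ u : Fin n → ℝ, (u, p.2) ∈ C ∧ Antitone u ∧ Majorizes u p.1}

/-- The convex hull of the union of the sets `X(Z,a,b,{F})` over the hole-free `F ∈ 𝓕`. -/
def holeFreeHull {n m : ℕ} (Z : Set (Pt n m)) (a b : ℝ) (𝓕 : Set (Set (Fin n → ℝ))) :
    Set (Pt n m) :=
  convexHull ℝ (⋃ F ∈ {F | F ∈ 𝓕 ∧ HoleFree a b F}, setX Z a b {F})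

/-! ### Extended formulations and their size -/

/-- A class of convex cones (containing the origin) that may be used in conic constraints, for
example no cone at all (linear formulations), all second-order cones, or all cones of positive
semidefinite matrices. -/
structure ConeClass : Type (u + 1) where
  /-- the names of the cones of the class -/
  index : Type u
  /-- the dimension of the space in which the cone lies -/
  dim : index → ℕ
  /-- the cone itself -/
  cone : ∀ k : index, PointedCone ℝ (Fin (dim k) → ℝ)

/-- An extended formulation over the class `𝒦`, for subsets of `V`: a finite system in the
original variable `v ∈ V` and finitely many additional real variables `w`, consisting of linear
(that is, affine) inequalities and of conic constraints that require an affine image of `(v, w)`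
to lie in a cone of the class. -/
structure ExtForm (𝒦 : ConeClass.{u}) (V : Type) [AddCommGroup V] [Module ℝ V] where
  /-- the number of additional variables -/
  aux : ℕ
  /-- the number of linear inequalities -/
  ineqs : ℕ
  /-- the linear inequalities `0 ≤ ineq i (v, w)` -/
  ineq : Fin ineqs → (V × (Fin aux → ℝ)) →ᵃ[ℝ] ℝ
  /-- the number of conic constraints -/
  conics : ℕ
  /-- the cones that occur -/
  kind : Fin conics → 𝒦.index
  /-- the conic constraints `conic j (v, w) ∈ 𝒦.cone (kind j)` -/
  conic : ∀ j : Fin conics, (V × (Fin aux → ℝ)) →ᵃ[ℝ] (Fin (𝒦.dim (kind j)) → ℝ)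

namespace ExtForm

variable {𝒦 : ConeClass.{u}} {V : Type} [AddCommGroup V] [Module ℝ V]

/-- The set described by the formulation: the projection to `V` of its feasible set. -/
def proj (E : ExtForm 𝒦 V) : Set V :=
  {v | ∃ w : Fin E.aux → ℝ,
    (∀ i, 0 ≤ E.ineq i (v, w)) ∧ ∀ j, E.conic j (v, w) ∈ 𝒦.cone (E.kind j)}

/-- The size of the formulation: the number of its variables, plus the number of its constraints,
plus the dimensions of the cones in its conic constraints. -/
noncomputable def size (E : ExtForm 𝒦 V) : ℕ :=
  (Module.finrank ℝ V + E.aux) + (E.ineqs + E.conics) + ∑ j, 𝒦.dim (E.kind j)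

end ExtForm

/-- `Y` has an extended formulation over `𝒦` of size at most `N`. -/
def HasExtForm (𝒦 : ConeClass.{u}) {V : Type} [AddCommGroup V] [Module ℝ V]
    (Y : Set V) (N : ℕ) : Prop :=
  ∃ E : ExtForm 𝒦 V, E.proj = Y ∧ E.size ≤ N

/-- The members of the family `Y` have extended formulations over `𝒦` whose size is bounded by a
polynomial in the parameter `s i`, the same polynomial for the whole family. -/
def HasPolySizeExtForm (𝒦 : ConeClass.{u}) {ι : Type v} (s : ι → ℕ) {n m : ι → ℕ}
    (Y : ∀ i, Set (Pt (n i) (m i))) : Prop :=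
  ∃ q : Polynomial ℕ, ∀ i, HasExtForm 𝒦 (Y i) (q.eval (s i))

end PermHull

open PermHull

namespace PermHull

/-! ### Sorting and majorization -/

/-! A point of a face can be sorted nonincreasingly, with ties broken so that the permuted face
becomes hole-free (`exists_perm_antitone_holeFree`). So every point of `setX` is majorized by a
sorted point of a hole-free face. The set `majorized C` is convex for convex `C`, because partial
sums of nonincreasing vectors are linear, and this gives one inclusion. The other is Rado's theorem
(`mem_convexHull_of_majorizes`): `x` is a convex combination of permutations of `u`, and the hull is
permutation-invariant.

For sizes, only the quadratically many hole-free faces matter. Each is a permutation of a given face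
and inherits its formulation by substitution. Their union is convexified by homogenizing and adding
(`hasExtForm_convexHull_iUnion`), where compactness excludes recession directions, and majorization
costs a quadratic linear system from LP duality (`majorizes_iff_exists`). If `n = 0` or `b ≤ a`, the
cube has at most one point and is handled directly. -/

theorem sortedDesc_eq_comp {n : ℕ} (x : Fin n → ℝ) :
    sortedDesc x = x ∘ (Fin.revPerm.trans (Tuple.sort x)) := rfl

theorem antitone_sortedDesc {n : ℕ} (x : Fin n → ℝ) : Antitone (sortedDesc x) :=
  fun _ _ h => Tuple.monotone_sort x (Fin.rev_le_rev.2 h)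

theorem sortedDesc_eq_of_antitone {n : ℕ} (x : Fin n → ℝ) (σ : Equiv.Perm (Fin n))
    (h : Antitone (x ∘ σ)) : sortedDesc x = x ∘ σ := by
  have h1 : Monotone (x ∘ (Fin.revPerm.trans σ)) := fun i j hij => h (Fin.rev_le_rev.2 hij)
  have h2 := Tuple.unique_monotone (Tuple.monotone_sort x) h1
  funext i
  simpa [sortedDesc] using congrFun h2 i.rev

theorem sortedDesc_of_antitone {n : ℕ} {x : Fin n → ℝ} (h : Antitone x) : sortedDesc x = x :=
  sortedDesc_eq_of_antitone x 1 h

theorem partialSum_eq_sum_ite {n : ℕ} (y : Fin n → ℝ) (j : ℕ) :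
    partialSum y j = ∑ i : Fin n, y i * (if (i : ℕ) < j then 1 else 0) := by
  simp [partialSum, Finset.sum_filter]

theorem partialSum_of_le {n : ℕ} (y : Fin n → ℝ) {j : ℕ} (h : n ≤ j) :
    partialSum y j = ∑ i, y i := by
  rw [partialSum, Finset.filter_true_of_mem]
  exact fun i _ => i.2.trans_le h

/-- Rearrangement inequality against the 0/1 weight of the first `j` indices. -/
theorem partialSum_comp_perm_le {n : ℕ} {y : Fin n → ℝ} (hy : Antitone y)
    (σ : Equiv.Perm (Fin n)) (j : ℕ) : partialSum (y ∘ σ) j ≤ partialSum y j := by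
  rw [partialSum_eq_sum_ite, partialSum_eq_sum_ite]
  refine Monovary.sum_comp_perm_mul_le_sum_mul (f := y) (Antitone.monovary hy ?_)
  intro i k hik
  have : (i : ℕ) ≤ k := hik
  dsimp only
  split_ifs <;> first | omega | norm_num

theorem partialSum_comp_le_sortedDesc {n : ℕ} (x : Fin n → ℝ) (σ : Equiv.Perm (Fin n)) (j : ℕ) :
    partialSum (x ∘ σ) j ≤ partialSum (sortedDesc x) j := by
  have h := partialSum_comp_perm_le (antitone_sortedDesc x)
    (σ.trans (Fin.revPerm.trans (Tuple.sort x)).symm) j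
  convert h using 2
  rw [sortedDesc_eq_comp]
  funext i
  simp

theorem partialSum_add {n : ℕ} (x y : Fin n → ℝ) (j : ℕ) :
    partialSum (x + y) j = partialSum x j + partialSum y j := by
  simp [partialSum, Finset.sum_add_distrib]

theorem partialSum_sub {n : ℕ} (x y : Fin n → ℝ) (j : ℕ) :
    partialSum (x - y) j = partialSum x j - partialSum y j := by
  simp [partialSum, Finset.sum_sub_distrib]

theorem partialSum_smul {n : ℕ} (c : ℝ) (x : Fin n → ℝ) (j : ℕ) :
    partialSum (c • x) j = c * partialSum x j := by
  simp [partialSum, Finset.mul_sum]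

theorem sum_sortedDesc {n : ℕ} (x : Fin n → ℝ) : ∑ i, sortedDesc x i = ∑ i, x i := by
  rw [sortedDesc_eq_comp]
  exact Equiv.sum_comp _ x

/-- For nonincreasing `u`, majorization of `x` only needs the sorted partial sums of `x`. -/
theorem majorizes_iff_sorted {n : ℕ} {u x : Fin n → ℝ} (hu : Antitone u) :
    Majorizes u x ↔
      (∀ j : ℕ, partialSum (sortedDesc x) j ≤ partialSum u j) ∧ ∑ i, x i = ∑ i, u i := by
  rw [Majorizes, sortedDesc_of_antitone hu, partialSum_of_le _ le_rfl, partialSum_of_le _ le_rfl,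
    sum_sortedDesc]
  constructor
  · rintro ⟨h1, h2⟩
    refine ⟨fun j => ?_, h2.symm⟩
    rcases Nat.eq_zero_or_pos j with rfl | hj
    · simp [partialSum]
    rcases lt_or_ge j n with hn | hn
    · exact h1 j hj hn
    · rw [partialSum_of_le _ hn, partialSum_of_le _ hn, sum_sortedDesc, h2]
  · rintro ⟨h1, h2⟩
    exact ⟨fun j _ _ => h1 j, h2.symm⟩

/-- Quantifying over all permutations replaces sorting by inequalities that are linear in `x` and
`u` jointly. -/
theorem majorizes_iff_perm {n : ℕ} {u x : Fin n → ℝ} (hu : Antitone u) :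
    Majorizes u x ↔
      (∀ (σ : Equiv.Perm (Fin n)) (j : ℕ), partialSum (x ∘ σ) j ≤ partialSum u j) ∧
        ∑ i, x i = ∑ i, u i := by
  rw [majorizes_iff_sorted hu]
  refine and_congr_left fun _ => ⟨fun h σ j => ?_, fun h j => ?_⟩
  · exact (partialSum_comp_le_sortedDesc x σ j).trans (h j)
  · rw [sortedDesc_eq_comp]
    exact h _ j

theorem partialSum_comp_castSucc {n : ℕ} (w : Fin (n + 1) → ℝ) {j : ℕ} (hj : j ≤ n) :
    partialSum (fun i : Fin n => w i.castSucc) j = partialSum w j := by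
  rw [partialSum_eq_sum_ite, partialSum_eq_sum_ite, Fin.sum_univ_castSucc]
  simp [Nat.not_lt.2 hj]

/-- Abel summation for a nonincreasing weight and nonnegative partial sums. -/
theorem mul_sum_le_sum_mul_of_antitone {n : ℕ} (d w : Fin (n + 1) → ℝ) (hd : Antitone d)
    (hw : ∀ j, 0 ≤ partialSum w j) : d (Fin.last n) * ∑ i, w i ≤ ∑ i, d i * w i := by
  induction n with
  | zero => simp
  | succ n ih =>
    have h1 := ih (fun i => d i.castSucc) (fun i => w i.castSucc)
      (fun i j hij => hd (Fin.castSucc_le_castSucc_iff.2 hij)) (fun j => by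
        rcases le_total j (n + 1) with hj | hj
        · rw [partialSum_comp_castSucc w hj]; exact hw j
        · rw [partialSum_of_le _ hj, ← partialSum_of_le _ le_rfl,
            partialSum_comp_castSucc w le_rfl]
          exact hw _)
    have h2 : 0 ≤ ∑ i : Fin (n + 1), w i.castSucc := by
      rw [← partialSum_of_le _ le_rfl, partialSum_comp_castSucc w le_rfl]
      exact hw _
    rw [Fin.sum_univ_castSucc, Fin.sum_univ_castSucc (f := fun i => d i * w i)]
    -- The induction hypothesis carries the weight of the last-but-one index; lowering it to the
    -- last weight is harmless since it multiplies a nonnegative sum.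
    have h3 : d (Fin.last (n + 1)) ≤ d (Fin.last n).castSucc := hd (Fin.le_last _)
    have h4 := mul_le_mul_of_nonneg_right h3 h2
    linarith

/-- Abel summation for `w - y`; the totals agree, so the boundary term vanishes. -/
theorem sum_mul_le_sum_mul_of_partialSum_le {n : ℕ} (d y w : Fin n → ℝ) (hd : Antitone d)
    (h : ∀ j, partialSum y j ≤ partialSum w j) (hs : ∑ i, y i = ∑ i, w i) :
    ∑ i, d i * y i ≤ ∑ i, d i * w i := by
  cases n with
  | zero => simp
  | succ n =>
    have h1 := mul_sum_le_sum_mul_of_antitone d (w - y) hd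
      (fun j => by rw [partialSum_sub]; linarith [h j])
    simp only [Pi.sub_apply, Finset.sum_sub_distrib, mul_sub, hs] at h1
    linarith

/-- Rado's theorem: a vector lies in the convex hull of the permutations of any vector that
majorizes it. -/
theorem mem_convexHull_of_majorizes {n : ℕ} {u x : Fin n → ℝ} (hu : Antitone u)
    (h : Majorizes u x) :
    x ∈ convexHull ℝ (Set.range fun σ : Equiv.Perm (Fin n) => u ∘ σ) := by
  by_contra hx
  obtain ⟨f, r, hf, hr⟩ := geometric_hahn_banach_closed_point (convex_convexHull ℝ _)
    (Set.Finite.isClosed_convexHull ℝ (Set.finite_range _)) hx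
  obtain ⟨c, hc⟩ : ∃ c : Fin n → ℝ, ∀ y, f y = ∑ i, c i * y i :=
    ⟨_, fun y => by
      have := LinearMap.pi_apply_eq_sum_univ f.toLinearMap y
      simp only [smul_eq_mul, mul_comm (y _)] at this
      exact this⟩
  -- Sorting the separating functional `c` by `σ` gives `f x ≤ f (u ∘ σ.symm)`, contradicting
  -- separation of `x` from the permutations of `u`.
  let σ := Fin.revPerm.trans (Tuple.sort c)
  obtain ⟨h1, h2⟩ := (majorizes_iff_perm hu).1 h
  have key := sum_mul_le_sum_mul_of_partialSum_le (c ∘ σ) (x ∘ σ) u (antitone_sortedDesc c) (h1 σ)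
    ((Equiv.sum_comp σ x).trans h2)
  have e1 : f x = ∑ i, (c ∘ σ) i * (x ∘ σ) i := by
    rw [hc]; exact (Equiv.sum_comp σ fun i => c i * x i).symm
  have e2 : f (u ∘ σ.symm) = ∑ i, (c ∘ σ) i * u i := by
    rw [hc, ← Equiv.sum_comp σ]
    simp
  have := hf _ (subset_convexHull ℝ _ ⟨σ.symm, rfl⟩)
  linarith

theorem convex_majorized {n m : ℕ} {C : Set (Pt n m)} (hC : Convex ℝ C) :
    Convex ℝ (majorized C) := by
  rintro ⟨x, z⟩ ⟨u, hu, hua, hum⟩ ⟨x', z'⟩ ⟨u', hu', hua', hum'⟩ s t hs ht hst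
  have ha : Antitone (s • u + t • u') := fun i j hij =>
    add_le_add (mul_le_mul_of_nonneg_left (hua hij) hs) (mul_le_mul_of_nonneg_left (hua' hij) ht)
  refine ⟨s • u + t • u', hC hu hu' hs ht hst, ha, ?_⟩
  rw [majorizes_iff_perm hua] at hum
  rw [majorizes_iff_perm hua'] at hum'
  rw [majorizes_iff_perm ha]
  constructor
  · intro σ j
    have e : (s • (x, z) + t • (x', z')).1 ∘ σ = s • (x ∘ σ) + t • (x' ∘ σ) := rfl
    rw [e, partialSum_add, partialSum_add, partialSum_smul, partialSum_smul, partialSum_smul,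
      partialSum_smul]
    exact add_le_add (mul_le_mul_of_nonneg_left (hum.1 σ j) hs)
      (mul_le_mul_of_nonneg_left (hum'.1 σ j) ht)
  · have e1 := hum.2
    have e2 := hum'.2
    simp only at e1 e2
    simp [Finset.sum_add_distrib, ← Finset.mul_sum, e1, e2]

/-! ### Permutations of points and of faces -/

/-- Permuting the `x` coordinates, as a linear automorphism. -/
def permPt {n : ℕ} (m : ℕ) (σ : Equiv.Perm (Fin n)) : Pt n m ≃ₗ[ℝ] Pt n m :=
  (LinearEquiv.funCongrLeft ℝ ℝ σ).prodCongr (LinearEquiv.refl ℝ _)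

theorem permPt_apply {n m : ℕ} (σ : Equiv.Perm (Fin n)) (p : Pt n m) :
    permPt m σ p = (p.1 ∘ σ, p.2) := rfl

theorem comp_mem_cube_iff {n : ℕ} {a b : ℝ} (σ : Equiv.Perm (Fin n)) (x : Fin n → ℝ) :
    x ∘ σ ∈ cube n a b ↔ x ∈ cube n a b :=
  ⟨fun h i => by simpa using h (σ.symm i), fun h i => h (σ i)⟩

theorem PermInvariant.comp_mem_iff {n m : ℕ} {Z : Set (Pt n m)} (hZ : PermInvariant Z)
    (σ : Equiv.Perm (Fin n)) (p : Pt n m) : (p.1 ∘ σ, p.2) ∈ Z ↔ p ∈ Z :=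
  ⟨fun h => by simpa [Function.comp_assoc] using hZ _ _ h σ.symm, fun h => hZ _ _ h σ⟩

theorem setX_permFace {n m : ℕ} {Z : Set (Pt n m)} (hZ : PermInvariant Z) (a b : ℝ)
    (F : Set (Fin n → ℝ)) (σ : Equiv.Perm (Fin n)) :
    setX Z a b {permFace σ F} = permPt m σ ⁻¹' setX Z a b {F} := by
  ext p
  simp [setX, permPt_apply, permFace, comp_mem_cube_iff, hZ.comp_mem_iff]

theorem convexHull_preimage_linearEquiv {V W : Type*} [AddCommGroup V] [Module ℝ V]
    [AddCommGroup W] [Module ℝ W] (e : V ≃ₗ[ℝ] W) (s : Set W) :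
    convexHull ℝ (e ⁻¹' s) = e ⁻¹' convexHull ℝ s := by
  have h := e.symm.toLinearMap.image_convexHull s
  have h' : ∀ t : Set W, e.symm.toLinearMap '' t = e ⁻¹' t := fun t =>
    e.symm.toEquiv.image_eq_preimage_symm t
  rw [h', h'] at h
  exact h.symm

theorem fixedAt_permFace {n : ℕ} (c : ℝ) (σ : Equiv.Perm (Fin n)) (F : Set (Fin n → ℝ)) :
    fixedAt c (permFace σ F) = {j | σ.symm j ∈ fixedAt c F} := by
  ext j
  constructor
  · intro h y hy
    have := h (y ∘ σ.symm) (by simpa [permFace, Function.comp_assoc] using hy)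
    simpa using this
  · intro h x hx
    simpa using h (x ∘ σ) hx

theorem isCubeFace_permFace {n : ℕ} {a b : ℝ} {F : Set (Fin n → ℝ)} (hF : IsCubeFace a b F)
    (σ : Equiv.Perm (Fin n)) : IsCubeFace a b (permFace σ F) := by
  rintro ⟨x, hx⟩
  obtain ⟨l, hl⟩ := hF ⟨_, hx⟩
  refine ⟨l.comp (ContinuousLinearMap.pi fun i => ContinuousLinearMap.proj (σ i)), ?_⟩
  ext y
  have : y ∈ permFace σ F ↔ y ∘ σ ∈ F := Iff.rfl
  rw [this, hl]
  constructor
  · rintro ⟨h1, h2⟩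
    exact ⟨(comp_mem_cube_iff σ y).1 h1, fun w hw => h2 _ ((comp_mem_cube_iff σ w).2 hw)⟩
  · rintro ⟨h1, h2⟩
    refine ⟨(comp_mem_cube_iff σ y).2 h1, fun w hw => ?_⟩
    have : l ((w ∘ σ.symm) ∘ σ) ≤ l (y ∘ σ) := h2 (w ∘ σ.symm) ((comp_mem_cube_iff _ w).2 hw)
    simpa [Function.comp_assoc] using this

/-! ### Hole-free faces suffice -/

theorem exists_initial_of_monotone {n : ℕ} (P Q : Fin n → Prop)
    (hP : ∀ i j, i ≤ j → P j → P i) (hQ : ∀ i j, i ≤ j → Q i → Q j) (hPQ : ∀ i, P i → ¬ Q i) :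
    ∃ p q : ℕ, p < q ∧ {j | P j} = {j : Fin n | (j : ℕ) + 1 ≤ p} ∧
      {j | Q j} = {j : Fin n | q ≤ (j : ℕ) + 1} := by
  classical
  have hp : ∃ p : ℕ, ∀ j : Fin n, P j → (j : ℕ) < p := ⟨n, fun j _ => j.2⟩
  have hq : ∃ q : ℕ, ∀ j : Fin n, q ≤ j → Q j := ⟨n, fun j hj => absurd j.2 (not_lt.2 hj)⟩
  -- Disjointness only gives `Nat.find hp ≤ Nat.find hq`; the shift to coordinates counted from 1
  -- makes it strict.
  refine ⟨Nat.find hp, Nat.find hq + 1, Nat.lt_succ_of_le (Nat.find_min' hp fun j hj => ?_),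
    ?_, ?_⟩
  · by_contra h
    exact hPQ j hj (Nat.find_spec hq j (not_lt.1 h))
  · ext j
    refine ⟨fun h => Nat.find_spec hp j h, fun h => ?_⟩
    by_contra hj
    have : Nat.find hp ≤ j := Nat.find_min' hp fun i hi => by
      by_contra hij
      exact hj (hP j i (not_lt.1 hij) hi)
    simp only [Set.mem_ofPred_eq] at h
    omega
  · ext j
    simp only [Set.mem_ofPred_eq, Nat.add_le_add_iff_right]
    exact ⟨fun h => Nat.find_min' hq fun i hi => hQ j i hi h, fun h => Nat.find_spec hq j h⟩

/-- Every point of a face can be sorted in such a way that the face becomes hole-free. -/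
theorem exists_perm_antitone_holeFree {n : ℕ} {a b : ℝ} (hab : a ≠ b) {F : Set (Fin n → ℝ)}
    {x : Fin n → ℝ} (hx : x ∈ F) (hc : x ∈ cube n a b) :
    ∃ σ : Equiv.Perm (Fin n), Antitone (x ∘ σ) ∧ HoleFree a b (permFace σ.symm F) := by
  classical
  -- Tie-breaking rank: coordinates fixed at `b` come first, those fixed at `a` last. No coordinate
  -- is both, since `F` is nonempty and `a ≠ b`.
  let f : Fin n → ℝ := fun i => if i ∈ fixedAt b F then -1 else if i ∈ fixedAt a F then 1 else 0
  have hb : ∀ i, f i < 0 ↔ i ∈ fixedAt b F := fun i => by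
    simp only [f]; split_ifs <;> simp_all
  have ha : ∀ i, 0 < f i ↔ i ∈ fixedAt a F := fun i => by
    simp only [f]; split_ifs with h1 h2
    · refine iff_of_false (by norm_num) fun h2 => hab ((h2 x hx).symm.trans (h1 x hx))
    · simp [h2]
    · simp [h2]
  have hf : ∀ i j, x i < x j → f j ≤ f i := fun i j hij => by
    simp only [f]
    have h1 : i ∉ fixedAt b F := fun h => by
      have := h x hx; have := (hc j).2; linarith
    have h2 : j ∉ fixedAt a F := fun h => by
      have := h x hx; have := (hc i).1; linarith
    rw [if_neg h1, if_neg h2]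
    split_ifs <;> norm_num
  -- By `hf` the rank never conflicts with the order of `x`, so one sort by `f - x` makes `x`
  -- nonincreasing and `f` nondecreasing at once.
  let σ := Tuple.sort fun i => f i - x i
  have hσ : ∀ i j, i ≤ j → f (σ i) - x (σ i) ≤ f (σ j) - x (σ j) :=
    Tuple.monotone_sort fun i => f i - x i
  have hx' : Antitone (x ∘ σ) := fun i j hij => by
    by_contra h
    have h1 : x (σ i) < x (σ j) := not_le.1 h
    linarith [hσ i j hij, hf _ _ h1]
  have hf' : ∀ i j, i ≤ j → f (σ i) ≤ f (σ j) := fun i j hij => by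
    rcases (hx' hij).lt_or_eq with h | h
    · exact hf _ _ h
    · have : x (σ j) = x (σ i) := h
      linarith [hσ i j hij]
  refine ⟨σ, hx', ?_⟩
  obtain ⟨p, q, hpq, h1, h2⟩ := exists_initial_of_monotone (fun j => f (σ j) < 0)
    (fun j => 0 < f (σ j)) (fun i j hij h => (hf' i j hij).trans_lt h)
    (fun i j hij h => h.trans_le (hf' i j hij)) (fun i h => not_lt.2 h.le)
  refine ⟨p, q, hpq, ?_, ?_⟩
  · rw [fixedAt_permFace, ← h1]
    simp only [hb, Equiv.symm_symm]
  · rw [fixedAt_permFace, ← h2]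
    simp only [ha, Equiv.symm_symm]

theorem holeFreeHull_subset {n m : ℕ} (Z : Set (Pt n m)) (a b : ℝ)
    (𝓕 : Set (Set (Fin n → ℝ))) : holeFreeHull Z a b 𝓕 ⊆ convexHull ℝ (setX Z a b 𝓕) := by
  refine convexHull_mono (Set.iUnion₂_subset ?_)
  rintro F ⟨hF, -⟩ p ⟨h1, h2, G, rfl, h3⟩
  exact ⟨h1, h2, G, hF, h3⟩

theorem FacesPermInvariant.setX_preimage {n m : ℕ} {Z : Set (Pt n m)} (hZ : PermInvariant Z)
    {𝓕 : Set (Set (Fin n → ℝ))} (h𝓕 : FacesPermInvariant 𝓕) (a b : ℝ)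
    (σ : Equiv.Perm (Fin n)) : permPt m σ ⁻¹' setX Z a b 𝓕 = setX Z a b 𝓕 := by
  ext p
  simp only [Set.mem_preimage, permPt_apply, setX, Set.mem_ofPred_eq, comp_mem_cube_iff,
    hZ.comp_mem_iff]
  refine and_congr_right fun _ => and_congr_right fun _ => ⟨?_, ?_⟩
  · rintro ⟨F, hF, h⟩
    exact ⟨_, h𝓕 F hF σ, h⟩
  · rintro ⟨F, hF, h⟩
    exact ⟨_, h𝓕 F hF σ.symm, by simpa [permFace, Function.comp_assoc] using h⟩

theorem convexHull_setX_eq_majorized {n m : ℕ} {a b : ℝ} (hab : a ≠ b) {Z : Set (Pt n m)}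
    {𝓕 : Set (Set (Fin n → ℝ))} (hZ : PermInvariant Z) (h𝓕 : FacesPermInvariant 𝓕) :
    convexHull ℝ (setX Z a b 𝓕) = majorized (holeFreeHull Z a b 𝓕) := by
  apply Set.Subset.antisymm
  · refine convexHull_min ?_ (convex_majorized (convex_convexHull ℝ _))
    rintro ⟨x, z⟩ ⟨hc, hz, F, hF, hx⟩
    obtain ⟨σ, hσ, hh⟩ := exists_perm_antitone_holeFree hab hx hc
    refine ⟨x ∘ σ, subset_convexHull ℝ _ (Set.mem_iUnion₂.2
      ⟨permFace σ.symm F, ⟨h𝓕 F hF σ.symm, hh⟩, (comp_mem_cube_iff σ x).2 hc, hZ x z hz σ, _,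
        rfl, by simpa [permFace, Function.comp_assoc] using hx⟩), hσ, ?_⟩
    rw [majorizes_iff_sorted hσ, sortedDesc_eq_of_antitone x σ hσ]
    exact ⟨fun _ => le_rfl, (Equiv.sum_comp σ x).symm⟩
  · rintro ⟨x, z⟩ ⟨u, hu, hua, hum⟩
    have hu' := holeFreeHull_subset _ _ _ _ hu
    -- The fibre of the hull over `z` is convex and contains all permutations of `u`, so Rado's
    -- theorem puts `x` in it.
    have hconv : Convex ℝ {y : Fin n → ℝ | (y, z) ∈ convexHull ℝ (setX Z a b 𝓕)} := by
      intro y hy y' hy' s t hs ht hst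
      have := convex_convexHull ℝ (setX Z a b 𝓕) hy hy' hs ht hst
      simpa [← add_smul, hst] using this
    refine convexHull_min (t := {y | (y, z) ∈ convexHull ℝ (setX Z a b 𝓕)}) ?_ hconv
      (mem_convexHull_of_majorizes hua hum)
    rintro _ ⟨σ, rfl⟩
    have := convexHull_preimage_linearEquiv (permPt m σ) (setX Z a b 𝓕)
    rw [h𝓕.setX_preimage hZ] at this
    rw [this] at hu'
    exact hu'

theorem facesPermInvariant_permClosure {n : ℕ} (𝓕 : Set (Set (Fin n → ℝ))) :
    FacesPermInvariant (permClosure 𝓕) := by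
  rintro _ ⟨F, hF, τ, rfl⟩ σ
  exact ⟨F, hF, τ.trans σ, rfl⟩

/-- Passing to `permClosure` enlarges `setX` but stays inside `setS`, so the hull is unchanged. -/
theorem convexHull_setS_eq_majorized {n m : ℕ} {a b : ℝ} (hab : a ≠ b) {Z : Set (Pt n m)}
    {𝓕 : Set (Set (Fin n → ℝ))} (hZ : PermInvariant Z)
    (h : convexHull ℝ (setS Z a b) = convexHull ℝ (setX Z a b 𝓕)) :
    convexHull ℝ (setS Z a b) = majorized (holeFreeHull Z a b (permClosure 𝓕)) := by
  rw [← convexHull_setX_eq_majorized hab hZ (facesPermInvariant_permClosure 𝓕)]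
  apply Set.Subset.antisymm
  · rw [h]
    refine convexHull_mono ?_
    rintro p ⟨h1, h2, F, hF, h3⟩
    exact ⟨h1, h2, F, ⟨F, hF, 1, rfl⟩, h3⟩
  · refine convexHull_mono ?_
    rintro p ⟨h1, h2, -⟩
    exact ⟨h1, h2⟩

/-! ### The number of hole-free faces -/

theorem apply_update {n : ℕ} (l : StrongDual ℝ (Fin n → ℝ)) (y : Fin n → ℝ)
    (j : Fin n) (c : ℝ) :
    l (Function.update y j c) = l y + (c - y j) * l (Pi.single j 1) := by
  have : Function.update y j c = y + (c - y j) • Pi.single j (1 : ℝ) := by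
    funext i
    rcases eq_or_ne i j with rfl | h
    · simp
    · simp [h]
  rw [this, map_add, map_smul, smul_eq_mul]

theorem update_mem_cube {n : ℕ} {a b c : ℝ} {y : Fin n → ℝ} (hy : y ∈ cube n a b) (j : Fin n)
    (h1 : a ≤ c) (h2 : c ≤ b) : Function.update y j c ∈ cube n a b := by
  intro i
  rcases eq_or_ne i j with rfl | h
  · simp [h1, h2]
  · simpa [h] using hy i

/-- A nonempty face is determined by its coordinates fixed at the bounds. -/
theorem face_eq_of_nonempty {n : ℕ} {a b : ℝ} (hab : a ≤ b) {F : Set (Fin n → ℝ)}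
    (hF : IsCubeFace a b F) (hne : F.Nonempty) :
    F = {x | x ∈ cube n a b ∧ ∀ j, (j ∈ fixedAt b F → x j = b) ∧ (j ∈ fixedAt a F → x j = a)} := by
  obtain ⟨l, hl⟩ := hF hne
  have hmem : ∀ y, y ∈ F ↔ y ∈ cube n a b ∧ ∀ w ∈ cube n a b, l w ≤ l y := fun y => by
    rw [hl]; rfl
  ext x
  constructor
  · exact fun hx => ⟨((hmem x).1 hx).1, fun j => ⟨fun h => h x hx, fun h => h x hx⟩⟩
  · rintro ⟨hx, hj⟩
    obtain ⟨y, hy⟩ := hne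
    have hsum : ∀ w : Fin n → ℝ, l w = ∑ j, w j * l (Pi.single j 1) := fun w => by
      conv_lhs => rw [← Finset.univ_sum_single w, map_sum]
      refine Finset.sum_congr rfl fun j _ => ?_
      rw [← smul_eq_mul, ← map_smul, ← Pi.single_smul, smul_eq_mul, mul_one]
    refine (hmem x).2 ⟨hx, fun w hw => (((hmem y).1 hy).2 w hw).trans ?_⟩
    rw [hsum, hsum x]
    refine Finset.sum_le_sum fun j _ => ?_
    -- A negative coefficient forces coordinate `j` to be `a` at every maximizer, a positive one
    -- forces `b`. So `x` and the maximizer `y` agree wherever the coefficient is nonzero.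
    rcases lt_trichotomy (l (Pi.single j 1)) 0 with h | h | h
    · have : j ∈ fixedAt a F := fun v hv => by
        have hv' := (hmem v).1 hv
        have h3 := hv'.2 _ (update_mem_cube hv'.1 j le_rfl hab)
        rw [apply_update] at h3
        have := (hv'.1 j).1
        by_contra hne
        have : a < v j := lt_of_le_of_ne this (Ne.symm hne)
        nlinarith
      rw [(hj j).2 this, this y hy]
    · simp [h]
    · have : j ∈ fixedAt b F := fun v hv => by
        have hv' := (hmem v).1 hv
        have h3 := hv'.2 _ (update_mem_cube hv'.1 j hab le_rfl)
        rw [apply_update] at h3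
        have := (hv'.1 j).2
        by_contra hne
        have : v j < b := lt_of_le_of_ne this hne
        nlinarith
      rw [(hj j).1 this, this y hy]

/-- Excludes the empty face, all of whose coordinates are vacuously fixed at both bounds: this would
need `p ≥ n ≥ 1 ≥ q`. -/
theorem not_holeFree_of_fixedAt_univ {n : ℕ} (hn : 1 ≤ n) {a b : ℝ} {F : Set (Fin n → ℝ)}
    (ha : fixedAt a F = Set.univ) (hb : fixedAt b F = Set.univ) : ¬ HoleFree a b F := by
  rintro ⟨p, q, hpq, h1, h2⟩
  have e1 : (⟨n - 1, by omega⟩ : Fin n) ∈ fixedAt b F := by rw [hb]; trivial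
  have e2 : (⟨0, by omega⟩ : Fin n) ∈ fixedAt a F := by rw [ha]; trivial
  rw [h1] at e1
  rw [h2] at e2
  simp only [Set.mem_ofPred_eq] at e1 e2
  omega

theorem encard_holeFree_faces_le (n : ℕ) (a b : ℝ) (hn : 1 ≤ n) :
    {F : Set (Fin n → ℝ) | IsCubeFace a b F ∧ HoleFree a b F}.encard ≤
      ((n + 2).choose 2 : ℕ) := by
  classical
  -- Pairs `p < q ≤ n + 1`, stored as `⟨q, p⟩`; there are `(n + 2).choose 2` of them.
  let T : Finset (Σ _ : ℕ, ℕ) := (Finset.range (n + 2)).sigma fun q => Finset.range q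
  let box : (Σ _ : ℕ, ℕ) → Set (Fin n → ℝ) := fun t =>
    {x | x ∈ cube n a b ∧ ∀ j : Fin n, ((j : ℕ) + 1 ≤ t.2 → x j = b) ∧
      (t.1 ≤ (j : ℕ) + 1 → x j = a)}
  have hsub : {F : Set (Fin n → ℝ) | IsCubeFace a b F ∧ HoleFree a b F} ⊆
      ((T.image box : Finset _) : Set (Set (Fin n → ℝ))) := by
    rintro F ⟨hF, hh⟩
    have hne : F.Nonempty := by
      by_contra h
      rw [Set.not_nonempty_iff_eq_empty] at h
      subst h
      exact not_holeFree_of_fixedAt_univ hn (by simp [fixedAt]) (by simp [fixedAt]) hh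
    have hcube : F ⊆ cube n a b := hF.subset
    have hab : a ≤ b := by
      obtain ⟨x, hx⟩ := hne
      exact ((hcube hx) ⟨0, by omega⟩).1.trans ((hcube hx) ⟨0, by omega⟩).2
    rw [Finset.coe_image]
    obtain ⟨p, q, hpq, h1, h2⟩ := hh
    have hFe := face_eq_of_nonempty hab hF hne
    rw [h1, h2] at hFe
    -- Thresholds beyond the last coordinate can be truncated without changing the face, and `p < q`
    -- survives.
    refine ⟨⟨min q (n + 1), min p n⟩, ?_, ?_⟩
    · simp only [T, Finset.coe_sigma, Set.mem_sigma_iff, Finset.coe_range, Set.mem_Iio]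
      omega
    · rw [hFe]
      ext x
      simp only [box, Set.mem_ofPred_eq]
      refine and_congr_right fun _ => forall_congr' fun j => and_congr ?_ ?_
      · have : (j : ℕ) + 1 ≤ min p n ↔ (j : ℕ) + 1 ≤ p := by have := j.2; omega
        rw [this]
      · have : min q (n + 1) ≤ (j : ℕ) + 1 ↔ q ≤ (j : ℕ) + 1 := by have := j.2; omega
        rw [this]
  refine (Set.encard_le_encard hsub).trans ?_
  rw [Set.encard_coe_eq_coe_finsetCard]
  refine Nat.cast_le.2 (Finset.card_image_le.trans (le_of_eq ?_))
  simp only [T, Finset.card_sigma, Finset.card_range]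
  rw [Finset.sum_range_id, Nat.choose_two_right]

/-! ### Building extended formulations -/

section Systems

variable {𝒦 : ConeClass.{u}} {V : Type} [AddCommGroup V] [Module ℝ V]

theorem HasExtForm.mono {Y : Set V} {N N' : ℕ} (h : HasExtForm 𝒦 Y N) (hN : N ≤ N') :
    HasExtForm 𝒦 Y N' := by
  obtain ⟨E, hE, hs⟩ := h
  exact ⟨E, hE, hs.trans hN⟩

/-- A system with arbitrary finite index types, an arbitrary finite-dimensional space of
additional variables, and a vector equation, yields an extended formulation. -/
theorem hasExtForm_of_system {W U I J : Type} [AddCommGroup W] [Module ℝ W]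
    [FiniteDimensional ℝ W] [AddCommGroup U] [Module ℝ U] [FiniteDimensional ℝ U]
    [Fintype I] [Fintype J]
    (ineq : I → (V × W) →ᵃ[ℝ] ℝ) (eqn : (V × W) →ᵃ[ℝ] U) (kind : J → 𝒦.index)
    (conic : ∀ j, (V × W) →ᵃ[ℝ] (Fin (𝒦.dim (kind j)) → ℝ)) :
    HasExtForm 𝒦 {v : V | ∃ w : W, (∀ i, 0 ≤ ineq i (v, w)) ∧ eqn (v, w) = 0 ∧
        ∀ j, conic j (v, w) ∈ 𝒦.cone (kind j)}
      ((Module.finrank ℝ V + Module.finrank ℝ W) +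
        ((Fintype.card I + 2 * Module.finrank ℝ U) + Fintype.card J) + ∑ j, 𝒦.dim (kind j)) := by
  classical
  let e : W ≃ₗ[ℝ] (Fin (Module.finrank ℝ W) → ℝ) := (Module.finBasis ℝ W).equivFun
  let bU := Module.finBasis ℝ U
  let K := I ⊕ (Fin (Module.finrank ℝ U) ⊕ Fin (Module.finrank ℝ U))
  let ψ : (V × (Fin (Module.finrank ℝ W) → ℝ)) →ᵃ[ℝ] V × W :=
    (LinearMap.id.prodMap e.symm.toLinearMap).toAffineMap
  have hψ : ∀ v w, ψ (v, w) = (v, e.symm w) := fun v w => rfl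
  -- Each coordinate of the equation becomes two opposite inequalities, hence the factor 2 in the
  -- size.
  let all : K → (V × W) →ᵃ[ℝ] ℝ := Sum.elim ineq
    (Sum.elim (fun k => (bU.coord k).toAffineMap.comp eqn)
      (fun k => (-bU.coord k).toAffineMap.comp eqn))
  let eK := Fintype.equivFin K
  let eJ := Fintype.equivFin J
  have hall : ∀ p, (∀ k, 0 ≤ all k p) ↔ (∀ i, 0 ≤ ineq i p) ∧ eqn p = 0 := fun p => by
    simp only [K, all, Sum.forall, Sum.elim_inl, Sum.elim_inr]
    refine and_congr_right fun _ => ⟨fun ⟨h1, h2⟩ => ?_, fun h => ?_⟩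
    · refine bU.ext_elem fun k => ?_
      have a1 : 0 ≤ bU.repr (eqn p) k := h1 k
      have a2 : 0 ≤ -bU.repr (eqn p) k := h2 k
      rw [map_zero, Finsupp.zero_apply]
      linarith
    · simp [h]
  refine ⟨⟨Module.finrank ℝ W, Fintype.card K, fun k => (all (eK.symm k)).comp ψ,
    Fintype.card J, fun j => kind (eJ.symm j), fun j => (conic (eJ.symm j)).comp ψ⟩, ?_, ?_⟩
  · ext v
    simp only [ExtForm.proj, Set.mem_ofPred_eq, AffineMap.comp_apply, hψ]
    constructor
    · rintro ⟨w, h1, h2⟩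
      obtain ⟨h3, h4⟩ := (hall (v, e.symm w)).1 fun k => by simpa using h1 (eK k)
      exact ⟨e.symm w, h3, h4, (eJ.forall_congr_left
        (p := fun j => conic j (v, e.symm w) ∈ 𝒦.cone (kind j))).2 h2⟩
    · rintro ⟨w, h1, h2, h3⟩
      refine ⟨e w, fun k => ?_, fun j => ?_⟩
      · rw [e.symm_apply_apply]
        exact (hall _).2 ⟨h1, h2⟩ _
      · rw [e.symm_apply_apply]
        exact h3 _
  · have h1 : ∑ j, 𝒦.dim (kind (eJ.symm j)) = ∑ j, 𝒦.dim (kind j) :=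
      Equiv.sum_comp eJ.symm fun j => 𝒦.dim (kind j)
    have h2 : Fintype.card K = Fintype.card I + 2 * Module.finrank ℝ U := by
      simp only [K, Fintype.card_sum, Fintype.card_fin]
      ring
    simp only [ExtForm.size, h1, h2, le_refl]

/-- Substitute `f` into every constraint. The dimension condition appears because the size counts
the variables of the ambient space. -/
theorem HasExtForm.preimage_linear {V' : Type} [AddCommGroup V'] [Module ℝ V'] {Y : Set V} {N : ℕ}
    (h : HasExtForm 𝒦 Y N) (f : V' →ₗ[ℝ] V)
    (hV : Module.finrank ℝ V' ≤ Module.finrank ℝ V) : HasExtForm 𝒦 (f ⁻¹' Y) N := by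
  obtain ⟨E, rfl, hs⟩ := h
  let ψ : (V' × (Fin E.aux → ℝ)) →ᵃ[ℝ] V × (Fin E.aux → ℝ) :=
    (f.prodMap LinearMap.id).toAffineMap
  refine ⟨⟨E.aux, E.ineqs, fun i => (E.ineq i).comp ψ, E.conics, E.kind,
    fun j => (E.conic j).comp ψ⟩, rfl, le_trans ?_ hs⟩
  simp only [ExtForm.size]
  omega

theorem hasExtForm_empty : HasExtForm 𝒦 (∅ : Set V) (Module.finrank ℝ V + 1) := by
  refine ⟨⟨0, 1, fun _ => AffineMap.const ℝ _ (-1), 0, Fin.elim0, fun j => j.elim0⟩, ?_, ?_⟩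
  · ext v
    simp only [ExtForm.proj, Set.mem_ofPred_eq, Set.mem_empty_iff_false, iff_false]
    rintro ⟨w, h, -⟩
    have := h 0
    simp only [AffineMap.const_apply] at this
    linarith
  · simp [ExtForm.size]

theorem ExtForm.convex_proj (E : ExtForm 𝒦 V) : Convex ℝ E.proj := by
  rintro v ⟨w, h1, h2⟩ v' ⟨w', h1', h2'⟩ s t hs ht hst
  have key : ∀ {X : Type} [AddCommGroup X] [Module ℝ X] (f : (V × (Fin E.aux → ℝ)) →ᵃ[ℝ] X),
      f (s • v + t • v', s • w + t • w') = s • f (v, w) + t • f (v', w') := fun f =>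
    Convex.combo_affine_apply (x := (v, w)) (y := (v', w')) hst
  refine ⟨s • w + t • w', fun i => ?_, fun j => ?_⟩
  · rw [key]
    exact add_nonneg (mul_nonneg hs (h1 i)) (mul_nonneg ht (h1' i))
  · rw [key]
    exact (𝒦.cone _).add_mem ((𝒦.cone _).smul_mem hs (h2 j))
      ((𝒦.cone _).smul_mem ht (h2' j))

/-! ### Homogenization and disjunction -/

/-- The homogenization of an affine map. -/
def homog {X Y : Type*} [AddCommGroup X] [Module ℝ X] [AddCommGroup Y] [Module ℝ Y]
    (f : X →ᵃ[ℝ] Y) : (X × ℝ) →ₗ[ℝ] Y :=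
  f.linear.coprod (LinearMap.toSpanSingleton ℝ Y (f 0))

theorem homog_apply {X Y : Type*} [AddCommGroup X] [Module ℝ X] [AddCommGroup Y] [Module ℝ Y]
    (f : X →ᵃ[ℝ] Y) (x : X) (r : ℝ) : homog f (x, r) = f.linear x + r • f 0 := by
  simp [homog]

theorem homog_one {X Y : Type*} [AddCommGroup X] [Module ℝ X] [AddCommGroup Y] [Module ℝ Y]
    (f : X →ᵃ[ℝ] Y) (x : X) : homog f (x, 1) = f x := by
  rw [homog_apply, one_smul]
  exact (congrFun f.decomp x).symm

namespace ExtForm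

/-- The points of the homogenized system of an extended formulation. -/
def HomogFeasible (E : ExtForm 𝒦 V) (p : (V × (Fin E.aux → ℝ)) × ℝ) : Prop :=
  (∀ i, 0 ≤ homog (E.ineq i) p) ∧ ∀ j, homog (E.conic j) p ∈ 𝒦.cone (E.kind j)

theorem HomogFeasible.smul {E : ExtForm 𝒦 V} {p : (V × (Fin E.aux → ℝ)) × ℝ}
    (h : E.HomogFeasible p) {c : ℝ} (hc : 0 ≤ c) : E.HomogFeasible (c • p) := by
  refine ⟨fun i => ?_, fun j => ?_⟩
  · rw [map_smul]; exact mul_nonneg hc (h.1 i)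
  · rw [map_smul]; exact (𝒦.cone _).smul_mem hc (h.2 j)

theorem HomogFeasible.add {E : ExtForm 𝒦 V} {p p' : (V × (Fin E.aux → ℝ)) × ℝ}
    (h : E.HomogFeasible p) (h' : E.HomogFeasible p') : E.HomogFeasible (p + p') := by
  refine ⟨fun i => ?_, fun j => ?_⟩
  · rw [map_add]; exact add_nonneg (h.1 i) (h'.1 i)
  · rw [map_add]; exact (𝒦.cone _).add_mem (h.2 j) (h'.2 j)

theorem homogFeasible_zero (E : ExtForm 𝒦 V) : E.HomogFeasible 0 :=
  ⟨fun i => by rw [map_zero], fun j => by rw [map_zero]; exact (𝒦.cone _).zero_mem⟩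

theorem mem_proj_iff_homogFeasible (E : ExtForm 𝒦 V) (v : V) :
    v ∈ E.proj ↔ ∃ w, E.HomogFeasible ((v, w), 1) := by
  simp only [HomogFeasible, homog_one]
  rfl

/-- If the described set is nonempty and has no recession direction, then every point of the
homogenized system is a nonnegative multiple of a point of the set. -/
theorem HomogFeasible.exists_smul {E : ExtForm 𝒦 V} {v : V} {w : Fin E.aux → ℝ} {r : ℝ}
    (h : E.HomogFeasible ((v, w), r)) (hr : 0 ≤ r) (hne : E.proj.Nonempty)
    (hrec : ∀ y d : V, (∀ s : ℝ, 0 ≤ s → y + s • d ∈ E.proj) → d = 0) :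
    ∃ y ∈ E.proj, v = r • y := by
  rcases hr.eq_or_lt with rfl | hr
  -- At height `r = 0` the vector `v` is a recession direction, hence zero, and any `y` serves.
  · obtain ⟨y, hy⟩ := hne
    refine ⟨y, hy, ?_⟩
    rw [zero_smul]
    refine hrec y v fun s hs => ?_
    obtain ⟨w', hw'⟩ := (E.mem_proj_iff_homogFeasible y).1 hy
    refine (E.mem_proj_iff_homogFeasible _).2 ⟨w' + s • w, ?_⟩
    have := hw'.add (h.smul hs)
    simpa using this
  · refine ⟨r⁻¹ • v, (E.mem_proj_iff_homogFeasible _).2 ⟨r⁻¹ • w, ?_⟩, ?_⟩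
    · have := h.smul (inv_nonneg.2 hr.le)
      simpa [inv_mul_cancel₀ hr.ne'] using this
    · rw [smul_inv_smul₀ hr.ne']

end ExtForm

/-- The convex hull of a finite union of nonempty bounded sets with extended formulations. -/
theorem hasExtForm_convexHull_iUnion [FiniteDimensional ℝ V] {T : Type} [Fintype T]
    (Y : T → Set V) (N : ℕ) (hY : ∀ t, HasExtForm 𝒦 (Y t) N) (hne : ∀ t, (Y t).Nonempty)
    (hrec : ∀ t, ∀ y d : V, (∀ s : ℝ, 0 ≤ s → y + s • d ∈ Y t) → d = 0) :
    HasExtForm 𝒦 (convexHull ℝ (⋃ t, Y t))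
      (3 * Module.finrank ℝ V + 2 + Fintype.card T * (N + 2)) := by
  classical
  choose E hE hs using hY
  obtain rfl : (fun t => (E t).proj) = Y := funext hE
  -- Each `t` gets its own homogenized copy `((v_t, w_t), r_t)` with `r_t ≥ 0`, linked by `∑ v_t =
  -- v` and `∑ r_t = 1`.
  let H : T → Type := fun t => (V × (Fin (E t).aux → ℝ)) × ℝ
  let W : Type := ∀ t, H t
  let pr : ∀ t, (V × W) →ₗ[ℝ] H t := fun t => (LinearMap.proj t).comp (LinearMap.snd ℝ V W)
  let ineq : (Σ t, Fin (E t).ineqs) ⊕ T → (V × W) →ᵃ[ℝ] ℝ := Sum.elim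
    (fun k => ((homog ((E k.1).ineq k.2)).comp (pr k.1)).toAffineMap)
    (fun t => ((LinearMap.snd ℝ _ ℝ).comp (pr t)).toAffineMap)
  let L : (V × W) →ₗ[ℝ] V × ℝ :=
    ((∑ t, ((LinearMap.fst ℝ V _).comp (LinearMap.fst ℝ _ ℝ)).comp (pr t)) -
      LinearMap.fst ℝ V W).prod (∑ t, (LinearMap.snd ℝ _ ℝ).comp (pr t))
  let eqn : (V × W) →ᵃ[ℝ] V × ℝ := L.toAffineMap - AffineMap.const ℝ _ (0, 1)
  let conic : ∀ k : (Σ t, Fin (E t).conics),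
      (V × W) →ᵃ[ℝ] (Fin (𝒦.dim ((E k.1).kind k.2)) → ℝ) :=
    fun k => ((homog ((E k.1).conic k.2)).comp (pr k.1)).toAffineMap
  have hform := hasExtForm_of_system ineq eqn (fun k : (Σ t, Fin (E t).conics) =>
    (E k.1).kind k.2) conic
  have hset : {v : V | ∃ w : W, (∀ i, 0 ≤ ineq i (v, w)) ∧ eqn (v, w) = 0 ∧
      ∀ j, conic j (v, w) ∈ 𝒦.cone ((E j.1).kind j.2)} =
      {v : V | ∃ w : W, (∀ t, (E t).HomogFeasible (w t)) ∧ (∀ t, 0 ≤ (w t).2) ∧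
        ∑ t, (w t).2 = 1 ∧ ∑ t, (w t).1.1 = v} := by
    ext v
    refine exists_congr fun w => ?_
    have h1 : (∀ i, 0 ≤ ineq i (v, w)) ↔
        (∀ t, ∀ i, 0 ≤ homog ((E t).ineq i) (w t)) ∧ ∀ t, 0 ≤ (w t).2 := by
      rw [Sum.forall, Sigma.forall]
      rfl
    have h2 : eqn (v, w) = 0 ↔ ∑ t, (w t).2 = 1 ∧ ∑ t, (w t).1.1 = v := by
      have : eqn (v, w) = (∑ t, (w t).1.1 - v, ∑ t, (w t).2 - 1) := by
        simp [eqn, L, pr]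
      rw [this, Prod.mk_eq_zero, sub_eq_zero, sub_eq_zero, and_comm]
    have h3 : (∀ j, conic j (v, w) ∈ 𝒦.cone ((E j.1).kind j.2)) ↔
        ∀ t, ∀ j, homog ((E t).conic j) (w t) ∈ 𝒦.cone ((E t).kind j) := by
      rw [Sigma.forall]
      rfl
    rw [h1, h2, h3]
    simp only [ExtForm.HomogFeasible, forall_and]
    tauto
  have hconv : Convex ℝ {v : V | ∃ w : W, (∀ t, (E t).HomogFeasible (w t)) ∧
      (∀ t, 0 ≤ (w t).2) ∧ ∑ t, (w t).2 = 1 ∧ ∑ t, (w t).1.1 = v} := by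
    rw [← hset]
    obtain ⟨E', hE', -⟩ := hform
    rw [← hE']
    exact E'.convex_proj
  have heq : convexHull ℝ (⋃ t, (E t).proj) =
      {v : V | ∃ w : W, (∀ t, (E t).HomogFeasible (w t)) ∧
      (∀ t, 0 ≤ (w t).2) ∧ ∑ t, (w t).2 = 1 ∧ ∑ t, (w t).1.1 = v} := by
    apply Set.Subset.antisymm
    · refine convexHull_min (Set.iUnion_subset fun t v hv => ?_) hconv
      obtain ⟨w, hw⟩ := ((E t).mem_proj_iff_homogFeasible v).1 hv
      refine ⟨Pi.single (M := H) t ((v, w), 1), fun t' => ?_, fun t' => ?_, ?_, ?_⟩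
      · rcases eq_or_ne t' t with rfl | h
        · rwa [Pi.single_eq_same]
        · rw [Pi.single_eq_of_ne h]; exact (E t').homogFeasible_zero
      · rcases eq_or_ne t' t with rfl | h
        · rw [Pi.single_eq_same]; exact zero_le_one
        · rw [Pi.single_eq_of_ne h]; exact le_rfl
      · rw [Fintype.sum_eq_single t fun t' h => by rw [Pi.single_eq_of_ne h]; rfl,
          Pi.single_eq_same]
      · rw [Fintype.sum_eq_single t fun t' h => by rw [Pi.single_eq_of_ne h]; rfl,
          Pi.single_eq_same]
    · rintro v ⟨w, h1, h2, h3, rfl⟩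
      choose y hy hyv using fun t => (h1 t).exists_smul (h2 t) (hne t) (hrec t)
      simp only [hyv]
      exact (convex_convexHull ℝ _).sum_mem (fun t _ => h2 t) h3 fun t _ =>
        subset_convexHull ℝ _ (Set.mem_iUnion.2 ⟨t, hy t⟩)
  rw [heq, ← hset]
  refine hform.mono ?_
  have hW : Module.finrank ℝ W = ∑ t, (Module.finrank ℝ V + (E t).aux + 1) := by
    rw [Module.finrank_pi_fintype]
    simp [H]
  have hdim : ∑ k : (Σ t, Fin (E t).conics), 𝒦.dim ((E k.1).kind k.2) =
      ∑ t, ∑ j, 𝒦.dim ((E t).kind j) := Fintype.sum_sigma _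
  -- A copy costs its original size plus 2, for the variable `r_t` and its sign constraint. The
  -- original variables and the doubled linking equation give `3 * finrank + 2`.
  have hsz : ∑ t, ((Module.finrank ℝ V + (E t).aux + 1) + ((E t).ineqs + (E t).conics) +
      ∑ j, 𝒦.dim ((E t).kind j) + 1) ≤ Fintype.card T * (N + 2) := by
    have : ∀ t ∈ Finset.univ, ((Module.finrank ℝ V + (E t).aux + 1) +
        ((E t).ineqs + (E t).conics) + ∑ j, 𝒦.dim ((E t).kind j) + 1) ≤ N + 2 := fun t _ => by
      have := hs t
      simp only [ExtForm.size] at this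
      omega
    refine (Finset.sum_le_card_nsmul _ _ _ this).trans ?_
    simp
  rw [hW, hdim]
  simp only [Finset.sum_add_distrib, Finset.sum_const, Finset.card_univ, smul_eq_mul,
    Fintype.card_sum, Fintype.card_sigma, Fintype.card_fin, Module.finrank_prod,
    Module.finrank_self, mul_one] at hsz ⊢
  omega

end Systems

/-! ### An extended formulation of majorization -/

theorem partialSum_const {n : ℕ} (c : ℝ) {j : ℕ} (hj : j ≤ n) :
    partialSum (fun _ : Fin n => c) j = j * c := by
  have h : (Finset.univ.filter fun i : Fin n => (i : ℕ) < j).card = j := by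
    rw [Fin.card_filter_val_lt]
    exact min_eq_right hj
  rw [partialSum, Finset.sum_const, h, nsmul_eq_mul]

/-- Majorization as the solvability of a linear system of quadratic size (the dual of the linear
program that computes the sum of the `k + 1` largest components). -/
theorem majorizes_iff_exists {n : ℕ} {u x : Fin n → ℝ} (hu : Antitone u) :
    Majorizes u x ↔ ∑ i, x i = ∑ i, u i ∧ ∃ (t : Fin n → ℝ) (s : Fin n → Fin n → ℝ),
      (∀ k i, 0 ≤ s k i) ∧ (∀ k i, x i - t k ≤ s k i) ∧
      ∀ k : Fin n, ((k : ℕ) + 1 : ℝ) * t k + ∑ i, s k i ≤ partialSum u (k + 1) := by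
  rw [majorizes_iff_sorted hu, and_comm]
  refine and_congr_right fun hsum => ?_
  have hsplit : ∀ (c : ℝ) (j : ℕ), j ≤ n → partialSum (sortedDesc x) j =
      partialSum (fun i => sortedDesc x i - c) j + j * c := fun c j hj => by
    have := partialSum_sub (sortedDesc x) (fun _ => c) j
    rw [partialSum_const c hj] at this
    have e : (sortedDesc x - fun _ => c) = fun i => sortedDesc x i - c := rfl
    rw [e] at this
    linarith
  constructor
  · intro h
    -- The optimal dual solution: `t k` is the `(k + 1)`-st largest component, and `s k` holds the
    -- positive parts of the excess over it.
    refine ⟨sortedDesc x, fun k i => max (x i - sortedDesc x k) 0, fun k i => le_max_right _ _,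
      fun k i => le_max_left _ _, fun k => ?_⟩
    have h1 : ∑ i, max (x i - sortedDesc x k) 0 =
        ∑ i, max (sortedDesc x i - sortedDesc x k) 0 :=
      (Equiv.sum_comp (Fin.revPerm.trans (Tuple.sort x))
        fun i => max (x i - sortedDesc x k) 0).symm
    have h2 : ∑ i, max (sortedDesc x i - sortedDesc x k) 0 =
        partialSum (fun i => sortedDesc x i - sortedDesc x k) (k + 1) := by
      rw [partialSum, Finset.sum_filter]
      refine Finset.sum_congr rfl fun i _ => ?_
      split_ifs with hi
      · exact max_eq_left (sub_nonneg.2 (antitone_sortedDesc x (Fin.le_def.2 (by omega))))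
      · exact max_eq_right (sub_nonpos.2 (antitone_sortedDesc x (Fin.le_def.2 (by omega))))
    have h3 := hsplit (sortedDesc x k) (k + 1) k.2
    have h4 := h (k + 1)
    push_cast at h3
    rw [h1, h2]
    linarith
  · rintro ⟨t, s, h0, h1, h2⟩ j
    rcases Nat.eq_zero_or_pos j with rfl | hj
    · simp [partialSum]
    rcases lt_or_ge n j with hn | hn
    · rw [partialSum_of_le _ hn.le, partialSum_of_le _ hn.le, sum_sortedDesc, hsum]
    obtain ⟨k, rfl⟩ : ∃ k, j = k + 1 := ⟨j - 1, by omega⟩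
    let k' : Fin n := ⟨k, hn⟩
    -- Weak duality: the excess of the `k + 1` largest components over `t k'` is bounded by their
    -- slacks, hence by all of the nonnegative slacks.
    have h3 : partialSum (fun i => sortedDesc x i - t k') (k + 1) ≤ ∑ i, s k' i := by
      let σ := Fin.revPerm.trans (Tuple.sort x)
      calc partialSum (fun i => sortedDesc x i - t k') (k + 1)
          ≤ partialSum (fun i => s k' (σ i)) (k + 1) :=
            Finset.sum_le_sum fun i _ => h1 k' (σ i)
        _ ≤ ∑ i, s k' (σ i) :=
            Finset.sum_le_sum_of_subset_of_nonneg (Finset.filter_subset _ _) fun i _ _ => h0 _ _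
        _ = ∑ i, s k' i := Equiv.sum_comp σ (s k')
    have h4 := h2 k'
    have h5 := hsplit (t k') (k + 1) hn
    push_cast at h5
    simp only [k'] at h3 h4 h5
    linarith

/-- The new variables `u`, `t`, `s` number `2n + n²`, the new inequalities `3n² + n`, and the sum
equation counts twice. -/
theorem HasExtForm.majorized {𝒦 : ConeClass.{u}} {n m N : ℕ} {C : Set (Pt n m)}
    (h : HasExtForm 𝒦 C N) :
    HasExtForm 𝒦 (majorized C) (N + (4 * (n * n) + 3 * n + 2)) := by
  classical
  obtain ⟨E, rfl, hs⟩ := h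
  let A : Type := Fin E.aux → ℝ
  let W : Type := ((Fin n → ℝ) × A) × ((Fin n → ℝ) × (Fin n → Fin n → ℝ))
  let X : Type := Pt n m × W
  let px : X →ₗ[ℝ] (Fin n → ℝ) := (LinearMap.fst ℝ _ _).comp (LinearMap.fst ℝ _ _)
  let pz : X →ₗ[ℝ] (Fin m → ℝ) := (LinearMap.snd ℝ _ _).comp (LinearMap.fst ℝ _ _)
  let pw : X →ₗ[ℝ] W := LinearMap.snd ℝ _ _
  let pu : X →ₗ[ℝ] (Fin n → ℝ) :=
    ((LinearMap.fst ℝ _ _).comp (LinearMap.fst ℝ _ _)).comp pw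
  let pa : X →ₗ[ℝ] A := ((LinearMap.snd ℝ _ _).comp (LinearMap.fst ℝ _ _)).comp pw
  let pt : X →ₗ[ℝ] (Fin n → ℝ) :=
    ((LinearMap.fst ℝ _ _).comp (LinearMap.snd ℝ _ _)).comp pw
  let ps : X →ₗ[ℝ] (Fin n → Fin n → ℝ) :=
    ((LinearMap.snd ℝ _ _).comp (LinearMap.snd ℝ _ _)).comp pw
  let co : Fin n → (Fin n → ℝ) →ₗ[ℝ] ℝ := fun i => LinearMap.proj i
  let ψ : X →ᵃ[ℝ] Pt n m × A := ((pu.prod pz).prod pa).toAffineMap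
  let I : Type := Fin E.ineqs ⊕ (Fin n × Fin n) ⊕ (Fin n × Fin n) ⊕ (Fin n × Fin n) ⊕ Fin n
  let ineq : I → X →ᵃ[ℝ] ℝ := Sum.elim (fun i => (E.ineq i).comp ψ) <|
    -- Monotonicity of `u` over all index pairs; pairs in the wrong order contribute `0 ≤ 0`.
    Sum.elim (fun q => (if q.1 ≤ q.2 then (co q.1).comp pu - (co q.2).comp pu else 0).toAffineMap)
    <| Sum.elim (fun q => ((co q.2).comp ((LinearMap.proj q.1).comp ps)).toAffineMap) <|
    Sum.elim (fun q => ((co q.2).comp ((LinearMap.proj q.1).comp ps) -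
      ((co q.2).comp px - (co q.1).comp pt)).toAffineMap)
    (fun k => ((∑ i ∈ Finset.univ.filter (fun i : Fin n => (i : ℕ) < k + 1), (co i).comp pu) -
      (((k : ℕ) + 1 : ℝ) • (co k).comp pt +
        ∑ i, (co i).comp ((LinearMap.proj k).comp ps))).toAffineMap)
  let eqn : X →ᵃ[ℝ] ℝ := ((∑ i, (co i).comp px) - ∑ i, (co i).comp pu).toAffineMap
  have hform := hasExtForm_of_system (V := Pt n m) (W := W) ineq eqn E.kind
    (fun j => (E.conic j).comp ψ)
  convert hform.mono ?_ using 1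
  · ext ⟨x, z⟩
    have key : ∀ (u : Fin n → ℝ) (w : A) (t : Fin n → ℝ) (s : Fin n → Fin n → ℝ),
        ((∀ i, 0 ≤ ineq i ((x, z), ((u, w), (t, s)))) ∧ eqn ((x, z), ((u, w), (t, s))) = 0 ∧
          ∀ j, ((E.conic j).comp ψ) ((x, z), ((u, w), (t, s))) ∈ 𝒦.cone (E.kind j)) ↔
        ((∀ i, 0 ≤ E.ineq i ((u, z), w)) ∧ ∀ j, E.conic j ((u, z), w) ∈ 𝒦.cone (E.kind j)) ∧
        Antitone u ∧ ∑ i, x i = ∑ i, u i ∧ (∀ k i, 0 ≤ s k i) ∧ (∀ k i, x i - t k ≤ s k i) ∧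
        ∀ k : Fin n, ((k : ℕ) + 1 : ℝ) * t k + ∑ i, s k i ≤ partialSum u (k + 1) := by
      intro u w t s
      have h0 : ψ ((x, z), ((u, w), (t, s))) = ((u, z), w) := rfl
      have h1 : eqn ((x, z), ((u, w), (t, s))) = 0 ↔ ∑ i, x i = ∑ i, u i := by
        rw [← sub_eq_zero (a := ∑ i, x i)]
        simp only [eqn, LinearMap.coe_toAffineMap, LinearMap.sub_apply, LinearMap.sum_apply]
        rfl
      have h2 : (∀ i, 0 ≤ ineq i ((x, z), ((u, w), (t, s)))) ↔
          (∀ i, 0 ≤ E.ineq i ((u, z), w)) ∧ Antitone u ∧ (∀ k i, 0 ≤ s k i) ∧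
          (∀ k i, x i - t k ≤ s k i) ∧
          ∀ k : Fin n, ((k : ℕ) + 1 : ℝ) * t k + ∑ i, s k i ≤ partialSum u (k + 1) := by
        simp only [I, ineq, Sum.forall, Sum.elim_inl, Sum.elim_inr, AffineMap.comp_apply, h0]
        refine and_congr_right fun _ => and_congr ?_ (and_congr ?_ (and_congr ?_ ?_))
        · refine Prod.forall.trans (forall_congr' fun i => forall_congr' fun j => ?_)
          by_cases hij : i ≤ j
          · simp only [hij, if_true, LinearMap.coe_toAffineMap, LinearMap.sub_apply, sub_nonneg]
            exact ⟨fun h _ => h, fun h => h trivial⟩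
          · simp [hij]
        · exact Prod.forall
        · refine Prod.forall.trans (forall_congr' fun i => forall_congr' fun j => ?_)
          rw [← sub_nonneg (b := x j - t i)]
          rfl
        · refine forall_congr' fun k => ?_
          rw [← sub_nonneg (b := ((k : ℕ) + 1 : ℝ) * t k + ∑ i, s k i)]
          simp only [LinearMap.coe_toAffineMap, LinearMap.sub_apply, LinearMap.add_apply,
            LinearMap.sum_apply]
          rfl
      rw [h1, h2]
      simp only [AffineMap.comp_apply, h0]
      tauto
    constructor
    · rintro ⟨u, ⟨w, hw⟩, hu, hum⟩
      obtain ⟨h1, t, s, h2⟩ := (majorizes_iff_exists hu).1 hum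
      exact ⟨((u, w), (t, s)), (key u w t s).2 ⟨hw, hu, h1, h2⟩⟩
    · rintro ⟨⟨⟨u, w⟩, t, s⟩, h⟩
      obtain ⟨hw, hu, h1, h2⟩ := (key u w t s).1 h
      exact ⟨u, ⟨w, hw⟩, hu, (majorizes_iff_exists hu).2 ⟨h1, t, s, h2⟩⟩
  · have hW : Module.finrank ℝ W = (n + E.aux) + (n + n * n) := by
      simp [W, A, Module.finrank_prod, Module.finrank_pi_fintype]
    rw [hW]
    simp only [ExtForm.size] at hs
    simp only [I, Fintype.card_sum, Fintype.card_prod, Fintype.card_fin, Module.finrank_self]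
    omega

/-! ### Polynomial size for the hull of `S(Z,a,b)` -/

/-- The place where compactness enters: a bounded hull contains no ray. -/
theorem setX_bounded_direction {n m : ℕ} {Z : Set (Pt n m)} (hZ : IsCompact Z) (a b : ℝ)
    (𝓕 : Set (Set (Fin n → ℝ))) (y d : Pt n m)
    (h : ∀ s : ℝ, 0 ≤ s → y + s • d ∈ convexHull ℝ (setX Z a b 𝓕)) : d = 0 := by
  have hb : Bornology.IsBounded (convexHull ℝ (setX Z a b 𝓕)) :=
    isBounded_convexHull.2 (hZ.isBounded.subset fun p hp => hp.2.1)
  obtain ⟨R, hR⟩ := hb.exists_norm_le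
  by_contra hd
  have hd' : 0 < ‖d‖ := norm_pos_iff.2 hd
  have hR0 : 0 ≤ R := (norm_nonneg _).trans (hR _ (h 0 le_rfl))
  have hs : 0 ≤ (R + ‖y‖ + 1) / ‖d‖ := by positivity
  have h1 := hR _ (h _ hs)
  have h2 : ‖((R + ‖y‖ + 1) / ‖d‖) • d‖ = R + ‖y‖ + 1 := by
    rw [norm_smul, Real.norm_of_nonneg hs, div_mul_cancel₀ _ hd'.ne']
  have h3 := norm_sub_le (y + ((R + ‖y‖ + 1) / ‖d‖) • d) y
  rw [add_sub_cancel_left, h2] at h3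
  linarith

/-- If `setX` is nonempty, some `F` contains the only point of the cube, so `F` alone already gives
`setS`. -/
theorem hasExtForm_of_cube_subsingleton {𝒦 : ConeClass.{u}} {n m N : ℕ} {a b : ℝ}
    {Z : Set (Pt n m)} {𝓕 : Set (Set (Fin n → ℝ))} (hsub : (cube n a b).Subsingleton)
    (h : convexHull ℝ (setS Z a b) = convexHull ℝ (setX Z a b 𝓕))
    (hF : ∀ F ∈ 𝓕, HasExtForm 𝒦 (convexHull ℝ (setX Z a b {F})) N) :
    HasExtForm 𝒦 (convexHull ℝ (setS Z a b)) (n + m + 1 + N) := by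
  rcases (setX Z a b 𝓕).eq_empty_or_nonempty with he | ⟨p, hp, -, F, hF', hpF⟩
  · rw [h, he, convexHull_empty]
    refine hasExtForm_empty.mono ?_
    simp [Module.finrank_prod]
  · have : setS Z a b = setX Z a b {F} := by
      ext q
      refine ⟨fun ⟨h1, h2⟩ => ⟨h1, h2, F, rfl, ?_⟩, fun ⟨h1, h2, _⟩ => ⟨h1, h2⟩⟩
      rwa [hsub h1 hp]
    rw [this]
    exact (hF F hF').mono (by omega)

theorem hasExtForm_setS {𝒦 : ConeClass.{u}} {n m N : ℕ} {a b : ℝ} {Z : Set (Pt n m)}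
    {𝓕 : Set (Set (Fin n → ℝ))} (hn : 1 ≤ n) (hab : a < b) (hc : IsCompact Z)
    (hZ : PermInvariant Z) (h𝓕 : ∀ F ∈ 𝓕, IsCubeFace a b F)
    (h : convexHull ℝ (setS Z a b) = convexHull ℝ (setX Z a b 𝓕))
    (hF : ∀ F ∈ 𝓕, HasExtForm 𝒦 (convexHull ℝ (setX Z a b {F})) N) :
    HasExtForm 𝒦 (convexHull ℝ (setS Z a b))
      (3 * (n + m) + 2 + (n + 2).choose 2 * (N + 2) + (4 * (n * n) + 3 * n + 2)) := by
  classical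
  rw [convexHull_setS_eq_majorized hab.ne hZ h]
  refine HasExtForm.majorized ?_
  -- Faces that contribute no point are dropped, since the disjunctive formulation requires nonempty
  -- pieces.
  let G : Set (Set (Fin n → ℝ)) :=
    {F | (F ∈ permClosure 𝓕 ∧ HoleFree a b F) ∧ (setX Z a b {F}).Nonempty}
  have hG : G ⊆ {F | IsCubeFace a b F ∧ HoleFree a b F} := by
    rintro _ ⟨⟨⟨F, hF, σ, rfl⟩, hh⟩, -⟩
    exact ⟨isCubeFace_permFace (h𝓕 F hF) σ, hh⟩
  obtain ⟨hfin, k, hk, hk'⟩ := Set.encard_le_coe_iff.1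
    ((Set.encard_le_encard hG).trans (encard_holeFree_faces_le n a b hn))
  have : Fintype G := hfin.fintype
  have hcard : Fintype.card G ≤ (n + 2).choose 2 := by
    rw [← Nat.card_eq_fintype_card, Nat.card_coe_set_eq, Set.ncard, hk]
    exact hk'
  have hhull : holeFreeHull Z a b (permClosure 𝓕) =
      convexHull ℝ (⋃ t : G, convexHull ℝ (setX Z a b {t.1})) := by
    apply Set.Subset.antisymm
    · refine convexHull_mono (Set.iUnion₂_subset fun F hF p hp => ?_)
      exact Set.mem_iUnion.2 ⟨⟨F, hF, p, hp⟩, subset_convexHull ℝ _ hp⟩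
    · refine convexHull_min (Set.iUnion_subset fun t => convexHull_mono ?_)
        (convex_convexHull ℝ _)
      exact Set.subset_iUnion₂_of_subset t.1 t.2.1 subset_rfl
  have hY : ∀ t : G, HasExtForm 𝒦 (convexHull ℝ (setX Z a b {t.1})) N := by
    rintro ⟨_, ⟨⟨F, hF', σ, rfl⟩, -⟩, -⟩
    rw [setX_permFace hZ, convexHull_preimage_linearEquiv]
    exact (hF F hF').preimage_linear (permPt m σ).toLinearMap le_rfl
  rw [hhull]
  refine (hasExtForm_convexHull_iUnion _ N hY (fun t => t.2.2.convexHull)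
    (fun t y d => setX_bounded_direction hc a b _ y d)).mono ?_
  have hd : Module.finrank ℝ (Pt n m) = n + m := by simp [Module.finrank_prod]
  rw [hd]
  exact Nat.add_le_add_left (Nat.mul_le_mul_right _ hcard) _

theorem cube_subsingleton {n : ℕ} {a b : ℝ} (h : ¬ (1 ≤ n ∧ a < b)) :
    (cube n a b).Subsingleton := by
  intro x hx y hy
  funext i
  have hba : b ≤ a := not_lt.1 fun hab => h ⟨by have := i.2; omega, hab⟩
  have := hx i
  have := hy i
  linarith

open Polynomial in
/-- The polynomial that bounds the size of the formulation of the hull of `S(Z,a,b)`. -/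
noncomputable def sizeBound : Polynomial ℕ :=
  3 * X + 2 + (X + 2) ^ 2 * (X + 2) + (4 * X ^ 2 + 3 * X + 2)

theorem sizeBound_eval (M : ℕ) : sizeBound.eval M =
    3 * M + 2 + (M + 2) ^ 2 * (M + 2) + (4 * M ^ 2 + 3 * M + 2) := by
  simp [sizeBound]

theorem hasExtForm_setS_sizeBound {𝒦 : ConeClass.{u}} {n m N : ℕ} {a b : ℝ} {Z : Set (Pt n m)}
    {𝓕 : Set (Set (Fin n → ℝ))} (hc : IsCompact Z) (hZ : PermInvariant Z)
    (h𝓕 : ∀ F ∈ 𝓕, IsCubeFace a b F)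
    (h : convexHull ℝ (setS Z a b) = convexHull ℝ (setX Z a b 𝓕))
    (hF : ∀ F ∈ 𝓕, HasExtForm 𝒦 (convexHull ℝ (setX Z a b {F})) N) :
    HasExtForm 𝒦 (convexHull ℝ (setS Z a b)) (sizeBound.eval (n + m + N)) := by
  rw [sizeBound_eval]
  by_cases hcase : 1 ≤ n ∧ a < b
  · refine (hasExtForm_setS hcase.1 hcase.2 hc hZ h𝓕 h hF).mono ?_
    have h1 : (n + 2).choose 2 ≤ (n + m + N + 2) ^ 2 :=
      (Nat.choose_le_pow _ _).trans (Nat.pow_le_pow_left (by omega) 2)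
    have h2 : n * n ≤ (n + m + N) ^ 2 := by
      rw [← sq]; exact Nat.pow_le_pow_left (by omega) 2
    have h3 : (n + 2).choose 2 * (N + 2) ≤ (n + m + N + 2) ^ 2 * (n + m + N + 2) :=
      Nat.mul_le_mul h1 (by omega)
    omega
  · refine (hasExtForm_of_cube_subsingleton (cube_subsingleton hcase) h hF).mono ?_
    generalize (n + m + N + 2) ^ 2 * (n + m + N + 2) = r
    generalize 4 * (n + m + N) ^ 2 = r'
    omega

theorem polynomial_eval_mono (q : Polynomial ℕ) : Monotone fun k : ℕ => q.eval k := by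
  intro k l hkl
  simp only [Polynomial.eval_eq_sum]
  exact Finset.sum_le_sum fun i _ => Nat.mul_le_mul_left _ (Nat.pow_le_pow_left hkl i)

end PermHull

theorem theorem11 :
    -- Families of instances: if the hulls on the given faces have polynomial-size extended
    -- formulations, then so have the hulls of `S(Z,a,b)`, however many faces there are.
    (∀ (𝒦 : ConeClass.{u}) (ι : Type v) (s n m : ι → ℕ) (a b : ι → ℝ)
        (Z : ∀ i, Set (Pt (n i) (m i))) (𝓕 : ∀ i, Set (Set (Fin (n i) → ℝ))),
        (∀ i, n i + m i ≤ s i) →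
        (∀ i, IsCompact (Z i)) →
        (∀ i, PermInvariant (Z i)) →
        (∀ i, ∀ F ∈ 𝓕 i, IsCubeFace (a i) (b i) F) →
        (∀ i, convexHull ℝ (setS (Z i) (a i) (b i)) =
          convexHull ℝ (setX (Z i) (a i) (b i) (𝓕 i))) →
        HasPolySizeExtForm 𝒦 (ι := Σ i, {F // F ∈ 𝓕 i}) (fun k => s k.1)
          (n := fun k => n k.1) (m := fun k => m k.1)
          (fun k => convexHull ℝ (setX (Z k.1) (a k.1) (b k.1) {k.2.1})) →
        HasPolySizeExtForm 𝒦 s (fun i => convexHull ℝ (setS (Z i) (a i) (b i)))) ∧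
    -- Single instances: one polynomial bounds the size for all instances.
    (∃ q : Polynomial ℕ, ∀ (𝒦 : ConeClass.{u}) (n m N : ℕ) (a b : ℝ) (Z : Set (Pt n m))
        (𝓕 : Set (Set (Fin n → ℝ))),
        IsCompact Z → PermInvariant Z →
        (∀ F ∈ 𝓕, IsCubeFace a b F) →
        convexHull ℝ (setS Z a b) = convexHull ℝ (setX Z a b 𝓕) →
        (∀ F ∈ 𝓕, HasExtForm 𝒦 (convexHull ℝ (setX Z a b {F})) N) →
        HasExtForm 𝒦 (convexHull ℝ (setS Z a b)) (q.eval (n + m + N))) ∧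
    -- The hole-free faces of a permutation-invariant collection, with majorization, suffice.
    (∀ (n m : ℕ) (a b : ℝ), a ≠ b → ∀ (Z : Set (Pt n m)) (𝓕 : Set (Set (Fin n → ℝ))),
        PermInvariant Z →
        (∀ F ∈ 𝓕, IsCubeFace a b F) → FacesPermInvariant 𝓕 →
        convexHull ℝ (setX Z a b 𝓕) = majorized (holeFreeHull Z a b 𝓕)) ∧
    -- For any collection that determines the hull of `S(Z,a,b)`, the hole-free permutations of
    -- its members, with majorization, describe that hull.
    (∀ (n m : ℕ) (a b : ℝ), a ≠ b → ∀ (Z : Set (Pt n m)) (𝓕 : Set (Set (Fin n → ℝ))),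
        PermInvariant Z →
        (∀ F ∈ 𝓕, IsCubeFace a b F) →
        convexHull ℝ (setS Z a b) = convexHull ℝ (setX Z a b 𝓕) →
        convexHull ℝ (setS Z a b) = majorized (holeFreeHull Z a b (permClosure 𝓕))) ∧
    -- There are at most `(n+2 choose 2)` hole-free faces.
    (∀ (n : ℕ) (a b : ℝ), 1 ≤ n →
        {F : Set (Fin n → ℝ) | IsCubeFace a b F ∧ HoleFree a b F}.encard ≤
          ((n + 2).choose 2 : ℕ)) := by
  refine ⟨?_, ⟨sizeBound, ?_⟩, ?_, ?_, encard_holeFree_faces_le⟩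
  · rintro 𝒦 ι s n m a b Z 𝓕 hs hc hZ h𝓕 h ⟨q, hq⟩
    -- Take `N = q (s i)`. As `n i + m i ≤ s i` and natural coefficients make evaluation monotone,
    -- `sizeBound` at `s i + q (s i)` suffices.
    refine ⟨sizeBound.comp (Polynomial.X + q), fun i => ?_⟩
    refine (hasExtForm_setS_sizeBound (hc i) (hZ i) (h𝓕 i) (h i)
      (N := q.eval (s i)) fun F hF => hq ⟨i, F, hF⟩).mono ?_
    simp only [Polynomial.eval_comp, Polynomial.eval_add, Polynomial.eval_X]
    exact polynomial_eval_mono sizeBound (Nat.add_le_add_right (hs i) _)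
  · intro 𝒦 n m N a b Z 𝓕 hc hZ h𝓕 h hF
    exact hasExtForm_setS_sizeBound hc hZ h𝓕 h hF
  · intro n m a b hab Z 𝓕 hZ _ h𝓕
    exact convexHull_setX_eq_majorized hab hZ h𝓕
  · intro n m a b hab Z 𝓕 hZ _ h
    exact convexHull_setS_eq_majorized hab hZ h
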